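/- Let $\underline{\mathbf{Hot}}$ be the 2-category whose objects are the topological spaces of the homotopy type of a CW-complex and whose hom-category from $X$ to $Y$ is $\Pi_1(Y^X)$, the fundamental groupoid of the space of continuous maps $X\to Y$ (with the compact-open topology); composition is induced by composition of maps. A 1-morphism $f:X\to Y$ of a 2-category $\mathcal K$ is an equivalence if there is a 1-morphism $g:Y\to X$ such that $gf$ and $fg$ are isomorphic to the identities in $\mathcal K(X,X)$ and $\mathcal K(Y,Y)$. A set $\mathcal G$ of objects of $\mathcal K$ jointly reflects equivalences if every 1-morphism $f:X\to Y$ such that, for all $S\in\mathcal G$, the induced functor $\mathcal K(S,f):\mathcal K(S,X)\to\mathcal K(S,Y)$ is an equivalence of categories, is itself an equivalence in $\mathcal K$. **Theorem.** The set $\{S^n \mid n\ge 0\}$ of spheres jointly reflects equivalences in $\underline{\mathbf{Hot}}$. That is, if $X$ and $Y$ have the homotopy type of CW-complexes and $f:X\to Y$ is a continuous map such that for every $n\ge 0$ the induced functor $\Pi_1(X^{S^n})\to\Pi_1(Y^{S^n})$ is an equivalence of groupoids, then $f$ is an equivalence in $\underline{\mathbf{Hot}}$, and indeed a homotopy equivalence.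 -/

import Mathlib

open CategoryTheory Topology

universe u

/-! ### Spaces of the homotopy type of a CW-complex -/

/-- `X` has the homotopy type of a CW-complex: it is homotopy equivalent to a (Hausdorff) space
`Z` carrying a CW structure. -/
def HasCWHomotopyType (X : Type u) [TopologicalSpace X] : Prop :=
  ∃ (Z : Type u) (_ : TopologicalSpace Z), T2Space Z ∧
    Nonempty (Topology.CWComplex (Set.univ : Set Z)) ∧
    Nonempty (ContinuousMap.HomotopyEquiv X Z)

/-! ### Composition maps on mapping spaces (with the compact-open topology) -/

namespace MappingSpace

/-- Postcomposition `Y^X → Z^X` with a map `g : Y → Z`. -/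
def post (X : Type*) {Y Z : Type*} [TopologicalSpace X] [TopologicalSpace Y] [TopologicalSpace Z]
    (g : C(Y, Z)) : C(C(X, Y), C(X, Z)) :=
  ⟨fun f => g.comp f, ContinuousMap.continuous_postcomp g⟩

/-- Precomposition `Z^Y → Z^X` with a map `f : X → Y`. -/
def pre {X Y : Type*} (Z : Type*) [TopologicalSpace X] [TopologicalSpace Y] [TopologicalSpace Z]
    (f : C(X, Y)) : C(C(Y, Z), C(X, Z)) :=
  ⟨fun g => g.comp f, ContinuousMap.continuous_precomp f⟩

variable {X Y Z W : Type*} [TopologicalSpace X] [TopologicalSpace Y] [TopologicalSpace Z]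
  [TopologicalSpace W]

/-- For Hausdorff `X`, a path in `Y^X` and a path in `Z^Y` compose to a continuous square
in `Z^X`. -/
theorem continuous_square [T2Space X] (a : C(unitInterval, C(X, Y)))
    (b : C(unitInterval, C(Y, Z))) :
    Continuous (fun p : unitInterval × unitInterval => (b p.2).comp (a p.1)) := by
  rw [continuous_iff_continuousAt]
  intro p
  rw [ContinuousAt, ContinuousMap.tendsto_compactOpen_iff_forall]
  intro K hK
  have : CompactSpace K := isCompact_iff_compactSpace.mp hK
  let a' : C(unitInterval × K, Y) :=
    ContinuousMap.uncurry ⟨fun s => (a s).restrict K,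
      (ContinuousMap.continuous_restrict K).comp a.continuous⟩
  let b' : C(unitInterval × (unitInterval × K), Z) :=
    ContinuousMap.uncurry ⟨fun t => (b t).comp a',
      (ContinuousMap.continuous_precomp a').comp b.continuous⟩
  let c : C((unitInterval × unitInterval) × K, Z) :=
    b'.comp ⟨fun q => (q.1.2, (q.1.1, q.2)), by fun_prop⟩
  exact c.curry.continuous.tendsto p

/-- Paths around a continuous square: both ways from corner to corner are homotopic. -/
theorem square_homotopic (F : C(unitInterval × unitInterval, W)) :
    Path.Homotopic
      ((((Path.refl (0 : unitInterval)).prod unitInterval.path01).map F.continuous).trans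
        ((unitInterval.path01.prod (Path.refl (1 : unitInterval))).map F.continuous))
      (((unitInterval.path01.prod (Path.refl (0 : unitInterval))).map F.continuous).trans
        (((Path.refl (1 : unitInterval)).prod unitInterval.path01).map F.continuous)) := by
  rw [← Path.map_trans, ← Path.map_trans]
  have : ContractibleSpace (Set.Icc (0 : ℝ) 1) :=
    (convex_Icc (0 : ℝ) 1).contractibleSpace ⟨0, by simp⟩
  have : ContractibleSpace unitInterval := this
  exact (SimplyConnectedSpace.paths_homotopic _ _).map F

/-- Precomposition of a path of maps with a map, as a path. -/
def prePath (f : C(X, Y)) {h k : C(Y, Z)} (q : Path h k) : Path (h.comp f) (k.comp f) where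
  toFun t := (q t).comp f
  continuous_toFun := (ContinuousMap.continuous_precomp f).comp q.continuous
  source' := by simp
  target' := by simp

/-- Postcomposition of a path of maps with a map, as a path. -/
def postPath {f g : C(X, Y)} (p : Path f g) (k : C(Y, Z)) : Path (k.comp f) (k.comp g) where
  toFun t := k.comp (p t)
  continuous_toFun := (ContinuousMap.continuous_postcomp k).comp p.continuous
  source' := by simp
  target' := by simp

/-- Interchange for paths of maps with Hausdorff source. -/
theorem interchange_path [T2Space X] {f g : C(X, Y)} {h k : C(Y, Z)}
    (p : Path f g) (q : Path h k) :
    Path.Homotopic ((prePath f q).trans (postPath p k)) ((postPath p h).trans (prePath g q)) := by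
  let F : C(unitInterval × unitInterval, C(X, Z)) :=
    ⟨_, continuous_square p.toContinuousMap q.toContinuousMap⟩
  have e00 : h.comp f = F (0, 0) := by simp [F]
  have e11 : k.comp g = F (1, 1) := by simp [F]
  have key := (square_homotopic F).pathCast e00 e11
  convert key using 1
  · refine Path.ext (funext fun t => ?_)
    simp only [Path.cast_coe, Path.trans_apply]
    split_ifs <;> simp [F, prePath, postPath, unitInterval.path01]
  · refine Path.ext (funext fun t => ?_)
    simp only [Path.cast_coe, Path.trans_apply]
    split_ifs <;> simp [F, prePath, postPath, unitInterval.path01]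

/-- Left whiskering: the functor `Π₁(Z^Y) → Π₁(Z^X)` induced by precomposition with
`f : X → Y`, on morphisms. -/
noncomputable def whiskerL (f : C(X, Y)) {h k : FundamentalGroupoid C(Y, Z)} (q : h ⟶ k) :
    (⟨h.as.comp f⟩ : FundamentalGroupoid C(X, Z)) ⟶ ⟨k.as.comp f⟩ :=
  (FundamentalGroupoid.map (pre Z f)).map q

/-- Right whiskering: the functor `Π₁(Y^X) → Π₁(Z^X)` induced by postcomposition with
`k : Y → Z`, on morphisms. -/
noncomputable def whiskerR {f g : FundamentalGroupoid C(X, Y)} (p : f ⟶ g) (k : C(Y, Z)) :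
    (⟨k.comp f.as⟩ : FundamentalGroupoid C(X, Z)) ⟶ ⟨k.comp g.as⟩ :=
  (FundamentalGroupoid.map (post X k)).map p

theorem whiskerL_comp (f : C(X, Y)) {h k l : FundamentalGroupoid C(Y, Z)} (q : h ⟶ k)
    (r : k ⟶ l) : whiskerL f (q ≫ r) = whiskerL f q ≫ whiskerL f r :=
  (FundamentalGroupoid.map (pre Z f)).map_comp q r

theorem whiskerR_comp {f g h : FundamentalGroupoid C(X, Y)} (p : f ⟶ g) (q : g ⟶ h)
    (k : C(Y, Z)) : whiskerR (p ≫ q) k = whiskerR p k ≫ whiskerR q k :=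
  (FundamentalGroupoid.map (post X k)).map_comp p q

theorem whiskerL_id_map {h k : FundamentalGroupoid C(Y, Z)} (q : h ⟶ k) :
    whiskerL (ContinuousMap.id Y) q = q := by
  obtain ⟨q, rfl⟩ := Path.Homotopic.Quotient.mk_surjective q
  rfl

theorem whiskerR_id_map {f g : FundamentalGroupoid C(X, Y)} (p : f ⟶ g) :
    whiskerR p (ContinuousMap.id Y) = p := by
  obtain ⟨p, rfl⟩ := Path.Homotopic.Quotient.mk_surjective p
  rfl

theorem whiskerL_whiskerL (f : C(X, Y)) (g : C(Y, Z)) {h k : FundamentalGroupoid C(Z, W)}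
    (q : h ⟶ k) : whiskerL (g.comp f) q = whiskerL f (whiskerL g q) := by
  obtain ⟨q, rfl⟩ := Path.Homotopic.Quotient.mk_surjective q
  rfl

theorem whiskerR_whiskerR {f g : FundamentalGroupoid C(X, Y)} (p : f ⟶ g) (h : C(Y, Z))
    (k : C(Z, W)) : whiskerR p (k.comp h) = whiskerR (whiskerR p h) k := by
  obtain ⟨p, rfl⟩ := Path.Homotopic.Quotient.mk_surjective p
  rfl

theorem whiskerR_whiskerL (f : C(X, Y)) {g h : FundamentalGroupoid C(Y, Z)} (p : g ⟶ h)
    (k : C(Z, W)) : whiskerR (whiskerL f p) k = whiskerL f (whiskerR p k) := by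
  obtain ⟨p, rfl⟩ := Path.Homotopic.Quotient.mk_surjective p
  rfl

/-- Interchange for homotopy classes of paths of maps, with Hausdorff source. -/
theorem interchange_of_t2 [T2Space X] {f g : FundamentalGroupoid C(X, Y)}
    {h k : FundamentalGroupoid C(Y, Z)} (p : f ⟶ g) (q : h ⟶ k) :
    whiskerL f.as q ≫ whiskerR p k.as = whiskerR p h.as ≫ whiskerL g.as q := by
  obtain ⟨p, rfl⟩ := Path.Homotopic.Quotient.mk_surjective p
  obtain ⟨q, rfl⟩ := Path.Homotopic.Quotient.mk_surjective q
  exact Quotient.sound (interchange_path p q)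

/-- A homotopy between maps `X → Y` induces one between precomposition maps `Z^Y → Z^X`. -/
theorem pre_homotopic {f g : C(X, Y)} (H : ContinuousMap.Homotopic f g) :
    ContinuousMap.Homotopic (pre Z f) (pre Z g) := by
  obtain ⟨H⟩ := H
  refine ⟨⟨⟨fun p => p.2.comp (H.toContinuousMap.curry p.1), ?_⟩, ?_, ?_⟩⟩
  · refine ContinuousMap.continuous_compactOpen.2 fun K hK U hU => isOpen_iff_mem_nhds.2 ?_
    rintro ⟨t, u⟩ htu
    have hn : IsOpen ((fun x => u (H x)) ⁻¹' U) := hU.preimage (by fun_prop)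
    obtain ⟨a, b, ha, -, hta, hKb, hab⟩ := generalized_tube_lemma
      (isCompact_singleton (x := t)) hK hn (by
        rintro ⟨s, x⟩ ⟨rfl, hx⟩
        exact htu hx)
    obtain ⟨J, hJ, hJa, hJc⟩ := local_compact_nhds (ha.mem_nhds (hta rfl))
    have hL : IsCompact (H '' (J ×ˢ K)) := (hJc.prod hK).image H.continuous
    have hu : Set.MapsTo u (H '' (J ×ˢ K)) U := by
      rintro _ ⟨⟨s, x⟩, ⟨hs, hx⟩, rfl⟩
      exact hab (Set.mk_mem_prod (hJa hs) (hKb hx))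
    filter_upwards [prod_mem_nhds hJ (ContinuousMap.eventually_mapsTo hL hU hu)]
    rintro ⟨s, v⟩ ⟨hs, hv⟩ x hx
    exact hv ⟨(s, x), ⟨hs, hx⟩, rfl⟩
  · intro x; ext y; simp [pre]
  · intro x; ext y; simp [pre]

/-- Precomposition with a homotopy equivalence is faithful on fundamental groupoids. -/
theorem whiskerL_injective (e : ContinuousMap.HomotopyEquiv X Y) {f g : FundamentalGroupoid C(X, Z)}
    {p q : f ⟶ g}
    (hpq : whiskerL e.invFun p = whiskerL e.invFun q) : p = q := by
  obtain ⟨H⟩ := pre_homotopic (Z := Z) e.left_inv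
  have h1 : (FundamentalGroupoid.map (pre Z (e.invFun.comp e.toFun))).map p =
      (FundamentalGroupoid.map (pre Z (e.invFun.comp e.toFun))).map q := by
    have := congrArg (whiskerL e.toFun) hpq
    rwa [← whiskerL_whiskerL, ← whiskerL_whiskerL] at this
  have h2 : (FundamentalGroupoid.map (pre Z (ContinuousMap.id X))).map p =
      (FundamentalGroupoid.map (pre Z (ContinuousMap.id X))).map q := by
    have np := (FundamentalGroupoidFunctor.homotopicMapsNatIso H).naturality p
    have nq := (FundamentalGroupoidFunctor.homotopicMapsNatIso H).naturality q
    rw [h1, nq] at np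
    exact ((cancel_epi _).1 np).symm
  have h3 : whiskerL (ContinuousMap.id X) p = whiskerL (ContinuousMap.id X) q := h2
  rwa [whiskerL_id_map, whiskerL_id_map] at h3

/-- Interchange for homotopy classes of paths of maps, when the source is homotopy equivalent to
a Hausdorff space. -/
theorem interchange {X' : Type*} [TopologicalSpace X'] [T2Space X']
    (e : ContinuousMap.HomotopyEquiv X X') {f g : FundamentalGroupoid C(X, Y)}
    {h k : FundamentalGroupoid C(Y, Z)} (p : f ⟶ g) (q : h ⟶ k) :
    whiskerL f.as q ≫ whiskerR p k.as = whiskerR p h.as ≫ whiskerL g.as q := by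
  apply whiskerL_injective e
  have key := interchange_of_t2 (whiskerL e.invFun p) q
  rw [whiskerL_comp, whiskerL_comp, ← whiskerR_whiskerL, ← whiskerR_whiskerL,
    ← whiskerL_whiskerL, ← whiskerL_whiskerL]
  exact key

end MappingSpace

/-! ### The homotopy 2-category of spaces -/

/-- An object of the homotopy 2-category of spaces: a topological space of the homotopy type of a
CW-complex. -/
structure TwoHot : Type (u + 1) where
  /-- The underlying type. -/
  carrier : Type u
  /-- The topology. -/
  [top : TopologicalSpace carrier]
  /-- It has the homotopy type of a CW-complex. -/
  hasCWHomotopyType : HasCWHomotopyType carrier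

namespace TwoHot

attribute [instance] TwoHot.top

instance : CoeSort TwoHot.{u} (Type u) := ⟨carrier⟩

/-- The 2-category of spaces: the hom-category from `X` to `Y` is the fundamental groupoid of the
mapping space `Y^X = C(X, Y)` with the compact-open topology, composition is composition of maps,
and whiskering is induced by precomposition and postcomposition on mapping spaces. It is strict:
associators and unitors are identities. -/
noncomputable instance : Bicategory TwoHot.{u} where
  Hom X Y := FundamentalGroupoid C(X, Y)
  id X := ⟨ContinuousMap.id X⟩
  comp f g := ⟨g.as.comp f.as⟩
  homCategory X Y := inferInstanceAs (Category (FundamentalGroupoid C(X, Y)))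
  whiskerLeft f _ _ η := MappingSpace.whiskerL f.as η
  whiskerRight η h := MappingSpace.whiskerR η h.as
  associator f g h := Iso.refl (⟨(h.as.comp g.as).comp f.as⟩ : FundamentalGroupoid C(_, _))
  leftUnitor f := Iso.refl f
  rightUnitor f := Iso.refl f
  whiskerLeft_id f g := rfl
  whiskerLeft_comp f _ _ _ η θ := MappingSpace.whiskerL_comp f.as η θ
  id_whiskerLeft η := (MappingSpace.whiskerL_id_map η).trans
    ((Category.id_comp _).trans (Category.comp_id _)).symm
  comp_whiskerLeft f g _ _ η := (MappingSpace.whiskerL_whiskerL f.as g.as η).trans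
    ((Category.id_comp _).trans (Category.comp_id _)).symm
  id_whiskerRight f g := rfl
  comp_whiskerRight η θ i := MappingSpace.whiskerR_comp η θ i.as
  whiskerRight_id η := (MappingSpace.whiskerR_id_map η).trans
    ((Category.id_comp _).trans (Category.comp_id _)).symm
  whiskerRight_comp η g h := (MappingSpace.whiskerR_whiskerR η g.as h.as).trans
    ((Category.id_comp _).trans (Category.comp_id _)).symm
  whisker_assoc f _ _ η h := (MappingSpace.whiskerR_whiskerL f.as η h.as).trans
    ((Category.id_comp _).trans (Category.comp_id _)).symm
  whisker_exchange {X _ _} _ _ _ _ η θ := by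
    obtain ⟨Z, _, _, -, ⟨e⟩⟩ := X.hasCWHomotopyType
    exact MappingSpace.interchange e η θ
  pentagon f g h i := by
    refine (Category.id_comp _).trans ?_
    rfl
  triangle f g := Category.id_comp _

end TwoHot

/-! ### Spheres -/

namespace SphereCW

/-- The cells of the standard CW structure on the `n`-sphere: one in dimension `0` and one in
dimension `n`. -/
inductive Cell (n : ℕ) : ℕ → Type u
  | base : Cell n 0
  | top : Cell n n

/-- The `n`-sphere as the one-point compactification of `ℝⁿ`. -/
abbrev Model (n : ℕ) : Type u := ULift.{u} (OnePoint (Fin n → ℝ))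

open Classical in
/-- The characteristic map of the top cell: it identifies the open unit ball with `ℝⁿ` and sends
everything else to infinity. -/
noncomputable def topFun (n : ℕ) (x : Fin n → ℝ) : Model.{u} n :=
  if ‖x‖ < 1 then ⟨((OpenPartialHomeomorph.univUnitBall.symm x : Fin n → ℝ) : OnePoint _)⟩
  else ⟨OnePoint.infty⟩

theorem topFun_of_lt {n : ℕ} {x : Fin n → ℝ} (hx : ‖x‖ < 1) : topFun.{u} n x =
    ⟨((OpenPartialHomeomorph.univUnitBall.symm x : Fin n → ℝ) : OnePoint _)⟩ := if_pos hx

theorem topFun_of_le {n : ℕ} {x : Fin n → ℝ} (hx : 1 ≤ ‖x‖) : topFun.{u} n x =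
    ⟨OnePoint.infty⟩ := if_neg hx.not_gt

theorem continuous_topFun (n : ℕ) : Continuous (topFun.{u} n) := by
  suffices h : Continuous fun x => (topFun.{u} n x).down from continuous_uliftUp.comp h
  rw [continuous_iff_continuousAt]
  intro x
  by_cases hx : ‖x‖ < 1
  · have hb : Metric.ball (0 : Fin n → ℝ) 1 ∈ 𝓝 x := Metric.isOpen_ball.mem_nhds (by simpa using hx)
    have hc : ContinuousAt (fun y : Fin n → ℝ =>
        ((OpenPartialHomeomorph.univUnitBall.symm y : Fin n → ℝ) : OnePoint (Fin n → ℝ))) x :=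
      OnePoint.continuous_coe.continuousAt.comp
        (OpenPartialHomeomorph.univUnitBall.symm.continuousAt (mem_ball_zero_iff.2 hx))
    refine hc.congr ?_
    filter_upwards [hb] with y hy
    rw [topFun_of_lt (by simpa using hy)]
  · have hx' : (topFun.{u} n x).down = OnePoint.infty := by rw [topFun_of_le (not_lt.1 hx)]
    rw [ContinuousAt, hx', Filter.Tendsto, OnePoint.le_nhds_infty]
    intro s _ hs
    have hK : IsCompact ((OpenPartialHomeomorph.univUnitBall : (Fin n → ℝ) → Fin n → ℝ) '' s) :=
      hs.image_of_continuousOn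
        (OpenPartialHomeomorph.univUnitBall.continuousOn.mono (Set.subset_univ s))
    have hxK : x ∉ (OpenPartialHomeomorph.univUnitBall : (Fin n → ℝ) → Fin n → ℝ) '' s := by
      rintro ⟨y, _, rfl⟩
      have := (OpenPartialHomeomorph.univUnitBall (E := Fin n → ℝ)).map_source
        (x := y) (Set.mem_univ _)
      exact hx (mem_ball_zero_iff.1 this)
    refine Filter.mem_map.2 ?_
    filter_upwards [hK.isClosed.isOpen_compl.mem_nhds hxK] with y hy
    by_cases hy1 : ‖y‖ < 1
    · left
      change (topFun.{u} n y).down ∈ _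
      rw [topFun_of_lt hy1]
      refine ⟨_, fun hmem => hy ⟨_, hmem, ?_⟩, rfl⟩
      exact OpenPartialHomeomorph.univUnitBall.right_inv (mem_ball_zero_iff.2 hy1)
    · right
      change (topFun.{u} n y).down ∈ _
      rw [topFun_of_le (not_lt.1 hy1)]
      rfl

/-- The characteristic map of the top cell. -/
noncomputable def topMap (n : ℕ) : PartialEquiv (Fin n → ℝ) (Model.{u} n) where
  toFun := topFun n
  invFun z := OnePoint.elim z.down 0 OpenPartialHomeomorph.univUnitBall
  source := Metric.ball 0 1
  target := {z | z.down ≠ OnePoint.infty}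
  map_source' x hx := by
    rw [topFun_of_lt (by simpa using hx)]
    exact OnePoint.coe_ne_infty _
  map_target' := by
    rintro ⟨z⟩ hz
    induction z using OnePoint.rec with
    | infty => exact absurd rfl hz
    | coe z => exact OpenPartialHomeomorph.univUnitBall.map_source (Set.mem_univ _)
  left_inv' x hx := by
    rw [topFun_of_lt (by simpa using hx)]
    exact OpenPartialHomeomorph.univUnitBall.right_inv hx
  right_inv' := by
    rintro ⟨z⟩ hz
    induction z using OnePoint.rec with
    | infty => exact absurd rfl hz
    | coe z =>
      have h1 : ‖(OpenPartialHomeomorph.univUnitBall z : Fin n → ℝ)‖ < 1 :=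
        mem_ball_zero_iff.1 ((OpenPartialHomeomorph.univUnitBall (E := Fin n → ℝ)).map_source
          (x := z) (Set.mem_univ _))
      refine (topFun_of_lt h1).trans ?_
      rw [OpenPartialHomeomorph.univUnitBall.left_inv (Set.mem_univ _)]

/-- The characteristic map of the `0`-cell, whose image is the point at infinity. -/
def baseMap (n : ℕ) : PartialEquiv (Fin 0 → ℝ) (Model.{u} n) where
  toFun _ := ⟨OnePoint.infty⟩
  invFun _ := 0
  source := Metric.ball 0 1
  target := {⟨OnePoint.infty⟩}
  map_source' _ _ := rfl
  map_target' _ _ := by simp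
  left_inv' _ _ := Subsingleton.elim _ _
  right_inv' _ h := h.symm

/-- The characteristic maps. -/
noncomputable def cellMap (n m : ℕ) : Cell.{u} n m → PartialEquiv (Fin m → ℝ) (Model.{u} n)
  | .base => baseMap n
  | .top => topMap n

/-- The standard CW structure on the `n`-sphere. -/
theorem nonempty_cwComplex (n : ℕ) :
    Nonempty (Topology.CWComplex (Set.univ : Set (Model.{u} n))) :=
  ⟨Topology.CWComplex.mkFinite Set.univ (Cell.{u} n) (cellMap n)
    (by
      filter_upwards [Filter.eventually_gt_atTop n] with m hm
      refine ⟨fun c => ?_⟩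
      cases c
      · exact absurd hm (Nat.not_lt_zero n)
      · exact lt_irrefl _ hm)
    (fun m => by
      refine Finite.of_injective (β := Bool) (fun c => match c with
        | .base => false
        | .top => true) ?_
      intro c c' h
      cases c <;> cases c' <;> first | rfl | exact absurd h (by simp))
    (fun m c => by cases c <;> rfl)
    (fun m c => by
      cases c
      · exact continuousOn_const
      · exact (continuous_topFun n).continuousOn)
    (fun m c => by
      cases c
      · exact continuousOn_const
      · rintro ⟨z⟩ hz
        induction z using OnePoint.rec with
        | infty => exact absurd rfl hz
        | coe z =>
          refine ContinuousAt.continuousWithinAt ?_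
          have h1 : ContinuousAt (fun w : OnePoint (Fin n → ℝ) =>
              OnePoint.elim w 0 (OpenPartialHomeomorph.univUnitBall : (Fin n → ℝ) → Fin n → ℝ))
              (z : OnePoint (Fin n → ℝ)) :=
            OnePoint.continuousAt_coe.2
              (OpenPartialHomeomorph.univUnitBall.continuousAt (Set.mem_univ _))
          exact ContinuousAt.comp
            (x := (⟨(z : OnePoint (Fin n → ℝ))⟩ : Model.{u} n)) (f := ULift.down) h1
            continuous_uliftDown.continuousAt)
    (by
      rintro ⟨m, c⟩ - ⟨m', c'⟩ - hne
      have hd : Disjoint (cellMap.{u} n _ .base '' Metric.ball 0 1)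
          (cellMap.{u} n _ .top '' Metric.ball 0 1) := by
        rw [Set.disjoint_left]
        rintro _ ⟨x, hx, rfl⟩ ⟨y, hy, hxy⟩
        exact (topMap.{u} n).map_source hy (congrArg ULift.down hxy)
      cases c <;> cases c'
      · exact absurd rfl hne
      · exact hd
      · exact hd.symm
      · exact absurd rfl hne)
    (fun m c => by
      cases c
      · intro x hx
        have h0 : ‖x‖ = 0 := by rw [Subsingleton.elim x 0, norm_zero]
        exact absurd ((mem_sphere_zero_iff_norm.1 hx).symm.trans h0) one_ne_zero
      · intro x hx
        rcases Nat.eq_zero_or_pos n with rfl | hn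
        · have h0 : ‖x‖ = 0 := by rw [Subsingleton.elim x 0, norm_zero]
          exact absurd ((mem_sphere_zero_iff_norm.1 hx).symm.trans h0) one_ne_zero
        · refine Set.mem_iUnion₂.2 ⟨0, hn, Set.mem_iUnion.2 ⟨.base, 0, by simp, ?_⟩⟩
          exact (topFun_of_le (by simpa using hx.ge)).symm)
    (by
      rw [Set.eq_univ_iff_forall]
      rintro ⟨z⟩
      induction z using OnePoint.rec with
      | infty => exact Set.mem_iUnion₂.2 ⟨0, .base, 0, by simp, rfl⟩
      | coe z =>
        have hz : (⟨(z : OnePoint (Fin n → ℝ))⟩ : Model.{u} n) ∈ (topMap n).target :=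
          OnePoint.coe_ne_infty z
        exact Set.mem_iUnion₂.2 ⟨n, .top, (topMap n).symm _,
          Metric.ball_subset_closedBall ((topMap n).map_target hz), (topMap n).right_inv hz⟩)⟩

end SphereCW

/-- The unit sphere in `ℝⁿ⁺¹` (placed in the universe `u`) has the homotopy type of a
CW-complex. -/
theorem hasCWHomotopyType_sphere (n : ℕ) : HasCWHomotopyType
    (ULift.{u} (Metric.sphere (0 : EuclideanSpace ℝ (Fin (n + 1))) 1)) :=
  ⟨SphereCW.Model.{u} n, inferInstance, inferInstance, SphereCW.nonempty_cwComplex n,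
    ⟨(Homeomorph.ulift.trans ((onePointEquivSphereOfFinrankEq
      (ι := Fin (n + 1)) (V := Fin n → ℝ) (by simp)).symm.trans
        Homeomorph.ulift.symm)).toHomotopyEquiv⟩⟩

namespace TwoHot

/-- The sphere `Sⁿ`, the unit sphere of `ℝⁿ⁺¹`, as an object of the 2-category of spaces. -/
def sphere (n : ℕ) : TwoHot.{u} where
  carrier := ULift.{u} (Metric.sphere (0 : EuclideanSpace ℝ (Fin (n + 1))) 1)
  hasCWHomotopyType := hasCWHomotopyType_sphere n

end TwoHot

/-! ### Joint reflection of equivalences in a 2-category -/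

/-- A 1-morphism `f : X ⟶ Y` is an equivalence if it has an inverse up to invertible
2-morphisms. -/
def IsOneEquivalence {K : Type*} [Bicategory K] {X Y : K} (f : X ⟶ Y) : Prop :=
  ∃ g : Y ⟶ X, Nonempty (f ≫ g ≅ 𝟙 X) ∧ Nonempty (g ≫ f ≅ 𝟙 Y)

/-- A set `G` of objects jointly reflects equivalences if every 1-morphism `f : X ⟶ Y` such that
`K(S, f) : K(S, X) ⥤ K(S, Y)` is an equivalence of categories for all `S ∈ G` is an equivalence. -/
def JointlyReflectsEquivalences {K : Type*} [Bicategory K] (G : Set K) : Prop :=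
  ∀ ⦃X Y : K⦄ (f : X ⟶ Y),
    (∀ S ∈ G, (Bicategory.postcomp S f).IsEquivalence) → IsOneEquivalence f

/-!
The proof is a version of Whitehead's theorem whose lifting argument only uses fullness on
fundamental groupoids and surjectivity on path components.

Let `f : X → Y` induce equivalences `Π₁(X^S) → Π₁(Y^S)` for all spheres `S`, and let `P → Y` be the
endpoint projection from the mapping path space of `f`. This projection has the right lifting
property against all inclusions `Sⁿ ⊆ Dⁿ⁺¹` (`hasBallLifting_endpoint`). Indeed, a lifting problem
provides a map `a : Sⁿ → X` and a path in `Y^{Sⁿ}` from `f ∘ a` to a constant map, which may be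
assumed to be the image of a constant map to `X` because `f` is surjective on path components. Since
the functor for `Sⁿ` is full, this path is homotopic rel endpoints to the image of a path in
`X^{Sⁿ}`; that path is a disc in `X` filling `a`, and the homotopy is what is needed to lift the
given disc (`exists_cone_lift`). Neither homotopy groups nor base points enter.

Working up the skeleta, every map from a CW complex to `Y` lifts to `P`
(`HasBallLifting.exists_lift`), which means that it factors through `f` up to homotopy. As `Y` is
homotopy equivalent to a CW complex, `f` has a right homotopy inverse `g`. By two-out-of-three, `g`
induces equivalences `Π₁(Y^S) → Π₁(X^S)` too, so it also has a right homotopy inverse, and `f` is a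
homotopy equivalence (`exists_homotopyEquiv_of_isEquivalence`). Lifting a single time to `P`, and
applying this to `g` as well, avoids cell structures on cylinders.
-/

/-! ### Lifting along the cells of a CW complex -/

/-- A map `p` has the ball lifting property if it has the right lifting property against the
inclusions of the unit spheres into the unit balls of `ℝⁿ` for all `n`. As in Mathlib's CW
complexes, `ℝⁿ` carries the maximum norm; maps on balls and spheres are encoded as functions on
`ℝⁿ` that are continuous on these sets. With this encoding the property says nothing about an empty
`P`. -/
def HasBallLifting {P Y : Type*} [TopologicalSpace P] [TopologicalSpace Y] (p : P → Y) : Prop :=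
  ∀ (n : ℕ) (a : (Fin n → ℝ) → P) (b : (Fin n → ℝ) → Y),
    ContinuousOn a (Metric.sphere 0 1) → ContinuousOn b (Metric.closedBall 0 1) →
    (∀ x ∈ Metric.sphere (0 : Fin n → ℝ) 1, p (a x) = b x) →
    ∃ l : (Fin n → ℝ) → P, ContinuousOn l (Metric.closedBall 0 1) ∧
      (∀ x ∈ Metric.sphere (0 : Fin n → ℝ) 1, l x = a x) ∧
      ∀ x ∈ Metric.closedBall (0 : Fin n → ℝ) 1, p (l x) = b x

namespace CWLifting

open Topology.RelCWComplex

variable {W P Y : Type*} [TopologicalSpace W] [T2Space W] [TopologicalSpace P]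
  [Topology.CWComplex (Set.univ : Set W)]

theorem isClosed_preimage_inter_closedCell {g : W → P} {m : ℕ} {j : cell (Set.univ : Set W) m}
    (hg : ContinuousOn (g ∘ map m j) (Metric.closedBall 0 1)) {K : Set P} (hK : IsClosed K) :
    IsClosed (g ⁻¹' K ∩ closedCell m j) := by
  have h1 : IsCompact (Metric.closedBall 0 1 ∩ (g ∘ map m j) ⁻¹' K) :=
    (isCompact_closedBall 0 1).of_isClosed_subset
      (hg.preimage_isClosed_of_isClosed Metric.isClosed_closedBall hK) Set.inter_subset_left
  have h2 := h1.image_of_continuousOn ((continuousOn m j).mono Set.inter_subset_left)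
  convert h2.isClosed using 1
  ext w
  constructor
  · rintro ⟨hw, x, hx, rfl⟩
    exact ⟨x, ⟨hx, hw⟩, rfl⟩
  · rintro ⟨x, ⟨hx, hw⟩, rfl⟩
    exact ⟨hw, x, hx, rfl⟩

/-- `g` is a continuous lift of `b` along `p` on every closed cell of dimension less than `n`. -/
def IsLiftBelow (p : P → Y) (b : W → Y) (n : ℕ) (g : W → P) : Prop :=
  ∀ m < n, ∀ j : cell (Set.univ : Set W) m,
    ContinuousOn (g ∘ map m j) (Metric.closedBall 0 1) ∧ ∀ w ∈ closedCell m j, p (g w) = b w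

theorem IsLiftBelow.apply_eq {p : P → Y} {b : W → Y} {n : ℕ} {g : W → P}
    (hg : IsLiftBelow p b n g) {w : W} (hw : w ∈ skeletonLT (Set.univ : Set W) n) :
    p (g w) = b w := by
  obtain ⟨m, hm, j, hj⟩ := Topology.CWComplex.mem_skeletonLT_iff.1 hw
  exact (hg m (by exact_mod_cast hm) j).2 w (openCell_subset_closedCell _ _ hj)

/-- The boundary of a cell meets only finitely many cells, so a lift below dimension `n` is
continuous along the attaching maps of the `n`-cells. -/
theorem IsLiftBelow.continuousOn_sphere {p : P → Y} {b : W → Y} {n : ℕ} {g : W → P}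
    (hg : IsLiftBelow p b n g) (j : cell (Set.univ : Set W) n) :
    ContinuousOn (g ∘ map n j) (Metric.sphere 0 1) := by
  obtain ⟨I, hI⟩ := Topology.CWComplex.mapsTo (C := (Set.univ : Set W)) n j
  rw [continuousOn_iff_isClosed]
  intro K hK
  let A : Set W := ⋃ (m ∈ Set.Iio n) (i ∈ I m), (g ⁻¹' K ∩ closedCell m i)
  have hA : IsClosed A := by
    refine (Set.finite_Iio n).isClosed_biUnion fun m hm => ?_
    exact (I m : Set (cell (Set.univ : Set W) m)).toFinite.isClosed_biUnion fun i _ =>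
      isClosed_preimage_inter_closedCell (hg m hm i).1 hK
  have hc := ((continuousOn n j).mono Metric.sphere_subset_closedBall).preimage_isClosed_of_isClosed
    Metric.isClosed_sphere hA
  refine ⟨_, hc, ?_⟩
  ext x
  constructor
  · rintro ⟨hx, hxs⟩
    refine ⟨⟨hxs, ?_⟩, hxs⟩
    obtain ⟨m, hm, i, hi, hmem⟩ := by simpa only [Set.mem_iUnion, exists_prop] using hI hxs
    exact Set.mem_biUnion hm (Set.mem_biUnion hi ⟨hx, hmem⟩)
  · rintro ⟨⟨hxs, hx⟩, -⟩
    obtain ⟨m, -, h⟩ := Set.mem_iUnion₂.1 hx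
    obtain ⟨i, -, hmem⟩ := Set.mem_iUnion₂.1 h
    exact ⟨hmem.1, hxs⟩

/-- The ball lifting property extends a lift over the `n`-cells, one cell at a time. -/
theorem IsLiftBelow.exists_succ [TopologicalSpace Y] {p : P → Y} (hp : HasBallLifting p) {b : W → Y}
    (hb : Continuous b) {n : ℕ} {g : W → P} (hg : IsLiftBelow p b n g) :
    ∃ g' : W → P, IsLiftBelow p b (n + 1) g' ∧
      Set.EqOn g' g (skeletonLT (Set.univ : Set W) n) := by
  classical
  have hfr : ∀ (j : cell (Set.univ : Set W) n), ∀ x ∈ Metric.sphere (0 : Fin n → ℝ) 1,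
      map n j x ∈ skeletonLT (Set.univ : Set W) n := fun j x hx =>
    cellFrontier_subset_skeletonLT n j ⟨x, hx, rfl⟩
  choose l hlc hls hlb using fun j : cell (Set.univ : Set W) n =>
    hp n (g ∘ map n j) (b ∘ map n j) (hg.continuousOn_sphere j)
      (hb.comp_continuousOn (continuousOn n j)) (fun x hx => hg.apply_eq (hfr j x hx))
  let g' : W → P := fun w =>
    if h : ∃ j : cell (Set.univ : Set W) n, w ∈ openCell n j
      then l h.choose ((map n h.choose).symm w) else g w
  have heq : Set.EqOn g' g (skeletonLT (Set.univ : Set W) n) := by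
    intro w hw
    refine dif_neg ?_
    rintro ⟨j, hj⟩
    exact Set.disjoint_left.1 (disjoint_skeletonLT_openCell le_rfl) hw hj
  have hcell : ∀ j : cell (Set.univ : Set W) n,
      Set.EqOn (g' ∘ map n j) (l j) (Metric.closedBall 0 1) := by
    intro j x hx
    rw [← Metric.sphere_union_ball] at hx
    rcases hx with hx | hx
    · exact (heq (hfr j x hx)).trans (hls j x hx).symm
    · have h : ∃ i : cell (Set.univ : Set W) n, map n j x ∈ openCell n i := ⟨j, x, hx, rfl⟩
      have hj : h.choose = j := by
        by_contra hne
        exact Set.disjoint_left.1 (disjoint_openCell_of_ne (by simpa using hne))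
          h.choose_spec ⟨x, hx, rfl⟩
      have hd : g' (map n j x) = l h.choose ((map n h.choose).symm (map n j x)) := dif_pos h
      rw [Function.comp_apply, hd, hj,
        (map n j).left_inv (by rw [source_eq]; exact hx)]
  refine ⟨g', fun m hm j => ?_, heq⟩
  rcases (Nat.lt_succ_iff_lt_or_eq.1 hm) with hm | rfl
  · have hsub : closedCell m j ⊆ (skeletonLT (Set.univ : Set W) n : Set W) :=
      (closedCell_subset_skeletonLT m j).trans
        (skeletonLT_mono (by exact_mod_cast Nat.succ_le_of_lt hm))
    refine ⟨(hg m hm j).1.congr fun x hx => heq (hsub ⟨x, hx, rfl⟩), fun w hw => ?_⟩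
    rw [heq (hsub hw), (hg m hm j).2 w hw]
  · refine ⟨(hlc j).congr (hcell j), ?_⟩
    rintro _ ⟨x, hx, rfl⟩
    exact (congrArg p (hcell j hx)).trans (hlb j x hx)

end CWLifting

open CWLifting Topology.RelCWComplex in
/-- Maps from a CW complex lift along a map with the ball lifting property, by induction over the
skeleta. -/
theorem HasBallLifting.exists_lift {W P Y : Type*} [TopologicalSpace W] [T2Space W]
    [TopologicalSpace P] [TopologicalSpace Y] [Topology.CWComplex (Set.univ : Set W)] {p : P → Y}
    (hp : HasBallLifting p) (h0 : Nonempty W → Nonempty P) {b : W → Y} (hb : Continuous b) :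
    ∃ g : W → P, Continuous g ∧ ∀ w, p (g w) = b w := by
  cases isEmpty_or_nonempty W with
  | inl hW => exact ⟨isEmptyElim, continuous_of_const fun w => isEmptyElim w, isEmptyElim⟩
  | inr hW =>
  obtain ⟨w₀⟩ := hW
  obtain ⟨q⟩ := h0 ⟨w₀⟩
  choose s hs hs' using fun (n : ℕ) (g : {g : W → P // IsLiftBelow p b n g}) =>
    g.2.exists_succ hp hb
  let G : ∀ n : ℕ, {g : W → P // IsLiftBelow p b n g} := fun n =>
    Nat.rec ⟨fun _ => q, fun m hm => absurd hm (Nat.not_lt_zero m)⟩ (fun n g => ⟨s n g, hs n g⟩) n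
  have hstep : ∀ (n : ℕ) (w : W), w ∈ skeletonLT (Set.univ : Set W) n →
      (G (n + 1)).1 w = (G n).1 w :=
    fun n w hw => hs' n (G n) hw
  have hmono : ∀ (n k : ℕ) (w : W), w ∈ skeletonLT (Set.univ : Set W) n →
      (G (n + k)).1 w = (G n).1 w := by
    intro n k w hw
    induction k with
    | zero => rfl
    | succ k ih =>
      rw [← ih]
      exact hstep (n + k) w (skeletonLT_mono (by exact_mod_cast Nat.le_add_right n k) hw)
  have hN : ∀ w : W, ∃ N : ℕ, w ∈ skeletonLT (Set.univ : Set W) N := by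
    intro w
    have : w ∈ (⋃ n : ℕ, (skeletonLT (Set.univ : Set W) n : Set W)) := by
      rw [iUnion_skeletonLT_eq_complex]; trivial
    simpa using this
  choose N hN using hN
  let g : W → P := fun w => (G (N w)).1 w
  have hgG : ∀ (n : ℕ) (w : W), w ∈ skeletonLT (Set.univ : Set W) n → g w = (G n).1 w := by
    intro n w hw
    rw [← hmono n (N w) w hw, add_comm, hmono (N w) n w (hN w)]
  refine ⟨g, ?_, fun w => (G (N w)).2.apply_eq (hN w)⟩
  rw [continuous_iff_isClosed]
  intro K hK
  rw [Topology.CWComplex.closed (Set.univ : Set W) _ (Set.subset_univ _)]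
  intro m j
  refine isClosed_preimage_inter_closedCell (((G (m + 1)).2 m m.lt_succ_self j).1.congr ?_) hK
  intro x hx
  exact hgG (m + 1) _ (closedCell_subset_skeletonLT m j ⟨x, hx, rfl⟩)

/-! ### The mapping path space and lifting on cones -/

open unitInterval

/-- The mapping path space of `f`: pairs of a point `x` and a path in `Y` starting at `f x`. -/
abbrev MappingPathSpace {X Y : Type*} [TopologicalSpace X] [TopologicalSpace Y] (f : C(X, Y)) :=
  {z : X × C(I, Y) // z.2 0 = f z.1}

/-- The endpoint projection, which replaces `f` by a fibration. -/
def MappingPathSpace.endpoint {X Y : Type*} [TopologicalSpace X] [TopologicalSpace Y]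
    (f : C(X, Y)) : C(MappingPathSpace f, Y) :=
  ⟨fun z => z.1.2 1, by fun_prop⟩

/-- First coordinate `u` of a map of squares `(r, t) ↦ (u, v)` whose second coordinate is
`squareMapSnd`. Let `K` be a path homotopy, with path parameter `u` and homotopy parameter `v`, from
`α` to a concatenation `(η * ρ) * δ`. The map is chosen such that, after pulling back `K`,
* the edge `t = 1` runs backwards through `ρ`, and the edge `r = 1` runs through `η`;
* the edge `t = 0` runs backwards through `α` for `r ≤ 1 / 2` and rests at its source for
  `1 / 2 ≤ r`;
* the edge `r = 0` only meets the target of `K` and the path `δ`. -/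
noncomputable def squareMapFst (z : I × I) : I :=
  Set.projIcc 0 1 zero_le_one
    (max (1 - 2 * (z.1 : ℝ) - max 0 (2 * (z.2 : ℝ) - 1) / 2) ((z.2 : ℝ) * (2 - z.1) / 4))

/-- Second coordinate of the map of squares described at `squareMapFst`. -/
noncomputable def squareMapSnd (z : I × I) : I :=
  Set.projIcc 0 1 zero_le_one (max (2 * (z.1 : ℝ) - 1) (min 1 (2 * (z.2 : ℝ))))

@[fun_prop]
theorem continuous_squareMapFst : Continuous squareMapFst := by
  unfold squareMapFst
  exact continuous_projIcc.comp (by fun_prop)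

@[fun_prop]
theorem continuous_squareMapSnd : Continuous squareMapSnd := by
  unfold squareMapSnd
  exact continuous_projIcc.comp (by fun_prop)

theorem squareMapFst_bottom {r : I} (hr : (1 / 2 : ℝ) ≤ r) : squareMapFst (r, 0) = 0 := by
  refine Set.projIcc_of_le_left _ ?_
  norm_num
  linarith

theorem squareMapSnd_bottom {r : I} (hr : (r : ℝ) ≤ 1 / 2) : squareMapSnd (r, 0) = 0 := by
  refine Set.projIcc_of_le_left _ ?_
  norm_num
  linarith

theorem squareMapSnd_top (r : I) : squareMapSnd (r, 1) = 1 := by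
  refine Set.projIcc_of_right_le _ ?_
  norm_num

theorem coe_squareMapFst_top (r : I) : (squareMapFst (r, 1) : ℝ) = (2 - r) / 4 := by
  have h0 := r.2.1
  have h1 := r.2.2
  have h : max (1 - 2 * (r : ℝ) - max 0 (2 * ((1 : I) : ℝ) - 1) / 2)
      (((1 : I) : ℝ) * (2 - r) / 4) = (2 - r) / 4 := by
    norm_num
    linarith
  rw [squareMapFst, h, Set.projIcc_of_mem _ ⟨by linarith, by linarith⟩]

theorem squareMapSnd_right (t : I) : squareMapSnd (1, t) = 1 := by
  refine Set.projIcc_of_right_le _ ?_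
  norm_num

theorem coe_squareMapFst_right (t : I) : (squareMapFst (1, t) : ℝ) = t / 4 := by
  have h0 := t.2.1
  have h1 := t.2.2
  have h : max (1 - 2 * ((1 : I) : ℝ) - max 0 (2 * (t : ℝ) - 1) / 2)
      ((t : ℝ) * (2 - (1 : I)) / 4) = t / 4 := by
    have := le_max_left (0 : ℝ) (2 * (t : ℝ) - 1)
    rw [max_eq_right] <;> norm_num
    linarith
  rw [squareMapFst, h, Set.projIcc_of_mem _ ⟨by linarith, by linarith⟩]

/-- On the edge `r = 0` the map of squares stays where a homotopy of paths rel endpoints is at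
the common target, or on the second half of the final path. -/
theorem squareMap_left (t : I) : squareMapFst (0, t) = 1 ∨
    squareMapSnd (0, t) = 1 ∧ (1 / 2 : ℝ) ≤ squareMapFst (0, t) := by
  have h0 := t.2.1
  have h1 := t.2.2
  rcases le_total (t : ℝ) (1 / 2) with h | h
  · left
    refine Set.projIcc_of_right_le _ (le_max_of_le_left ?_)
    rw [max_eq_left (by linarith)]
    norm_num
  · right
    constructor
    · refine Set.projIcc_of_right_le _ (le_max_of_le_right ?_)
      exact le_min le_rfl (by simpa using by linarith)
    · rw [squareMapFst, Set.coe_projIcc]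
      refine le_max_of_le_right (le_min (by norm_num) (le_max_of_le_left ?_))
      rw [max_eq_right (by simpa using by linarith)]
      norm_num
      linarith

/-- Lifting along the endpoint projection, for a map `b` on the cone over `S` (encoded as a map on
the cylinder that is constant at `r = 0`) and a lift `a` on its base `r = 1`.

The lift `a` consists of a map `a₀ : S → X` and a homotopy from `f ∘ a₀` to the base of `b`.
Following this homotopy, then the cone, then `δ`, gives a path in `Y^S` from `f ∘ a₀` to `f` of a
constant map. By fullness it is homotopic rel endpoints to the image of a path `α` in `X^S` from
`a₀` to a constant. The path `α` is the `X`-component of the lift on the cone, and the homotopy of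
paths, reparametrized by `squareMapFst` and `squareMapSnd`, is its path component. -/
theorem exists_cone_lift {S X Y : Type*} [TopologicalSpace S] [LocallyCompactSpace S]
    [TopologicalSpace X] [TopologicalSpace Y] {f : C(X, Y)}
    (hf : (FundamentalGroupoid.map (MappingSpace.post S f)).Full)
    (a : C(S, MappingPathSpace f)) (b : C(S × I, Y)) {y₀ : Y} {x₀ : X} (δ : Path y₀ (f x₀))
    (hb₁ : ∀ s, b (s, 1) = MappingPathSpace.endpoint f (a s)) (hb₀ : ∀ s, b (s, 0) = y₀) :
    ∃ L : C(S × I, MappingPathSpace f), (∀ s, L (s, 1) = a s) ∧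
      (∀ z, MappingPathSpace.endpoint f (L z) = b z) ∧ ∀ s s', L (s, 0) = L (s', 0) := by
  let a₀ : C(S, X) := ⟨fun s => (a s).1.1, by fun_prop⟩
  let βH : Path (f.comp a₀) (⟨fun s => b (s, 1), by fun_prop⟩ : C(S, Y)) :=
    { toContinuousMap := ContinuousMap.curry ⟨fun z : I × S => (a z.2).1.2 z.1, by fun_prop⟩
      source' := by ext s; exact (a s).2
      target' := by ext s; exact (hb₁ s).symm }
  let βb : Path (⟨fun s => b (s, 1), by fun_prop⟩ : C(S, Y)) (ContinuousMap.const S y₀) :=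
    { toContinuousMap := ContinuousMap.curry ⟨fun z : I × S => b (z.2, σ z.1), by fun_prop⟩
      source' := by ext s; simp
      target' := by ext s; simp [hb₀] }
  let βδ : Path (ContinuousMap.const S y₀) (f.comp (ContinuousMap.const S x₀)) :=
    { toContinuousMap := ContinuousMap.curry ⟨fun z : I × S => δ z.1, by fun_prop⟩
      source' := by ext s; simp
      target' := by ext s; simp }
  obtain ⟨αq, hα⟩ := hf.map_surjective (X := ⟨a₀⟩) (Y := ⟨ContinuousMap.const S x₀⟩)
    (Path.Homotopic.Quotient.mk ((βH.trans βb).trans βδ))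
  obtain ⟨α, rfl⟩ := Path.Homotopic.Quotient.mk_surjective αq
  obtain ⟨K⟩ : Path.Homotopic (α.map (MappingSpace.post S f).continuous)
    ((βH.trans βb).trans βδ) := Quotient.exact hα
  let A : C(I × S, X) := ContinuousMap.uncurry α.toContinuousMap
  let B : C((I × I) × S, Y) := ContinuousMap.uncurry K.toContinuousMap
  -- The values of the homotopy `K` on the four edges of the square, and on the three parts of the
  -- edge `v = 1`.
  have hA0 : ∀ s, A (0, s) = (a s).1.1 := fun s => congrArg (fun g : C(S, X) => g s) α.source
  have hA1 : ∀ s, A (1, s) = x₀ := fun s => congrArg (fun g : C(S, X) => g s) α.target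
  have hBα : ∀ u s, B ((0, u), s) = f (A (u, s)) := fun u s =>
    congrArg (fun g : C(S, Y) => g s) (K.apply_zero u)
  have hB0 : ∀ v s, B ((v, 0), s) = f (A (0, s)) := fun v s =>
    (congrArg (fun g : C(S, Y) => g s) (K.source v)).trans (congrArg f (hA0 s).symm)
  have hB1 : ∀ v s, B ((v, 1), s) = f x₀ := fun v s =>
    congrArg (fun g : C(S, Y) => g s) (K.target v)
  have hBβ : ∀ u s, B ((1, u), s) = ((βH.trans βb).trans βδ) u s := fun u s =>
    congrArg (fun g : C(S, Y) => g s) (K.apply_one u)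
  have hβH : ∀ (u t : I) s, (u : ℝ) = t / 4 → B ((1, u), s) = (a s).1.2 t := by
    intro u t s hu
    have ht := t.2.2
    rw [hBβ, Path.trans_apply, dif_pos (by linarith), Path.trans_apply,
      dif_pos (by simp only; linarith)]
    refine congrArg (a s).1.2 (Subtype.ext ?_)
    simp only
    linarith
  have hβb : ∀ (u r : I) s, (u : ℝ) = (2 - r) / 4 → B ((1, u), s) = b (s, r) := by
    intro u r s hu
    have h0 := r.2.1
    have h1 := r.2.2
    rcases h1.eq_or_lt with h1 | h1
    · obtain rfl : r = 1 := Subtype.ext h1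
      rw [hβH u 1 s (by rw [hu]; norm_num), hb₁]
      rfl
    · rw [hBβ, Path.trans_apply, dif_pos (by linarith), Path.trans_apply,
        dif_neg (by simp only; linarith)]
      refine congrArg (fun q => b (s, q)) (Subtype.ext ?_)
      simp only [unitInterval.coe_symm_eq]
      linarith
  have hβδ : ∀ (u : I) s s', (1 / 2 : ℝ) ≤ u → B ((1, u), s) = B ((1, u), s') := by
    intro u s s' hu
    rcases hu.eq_or_lt with hu | hu
    · rw [hβb u 0 s (by rw [← hu]; norm_num), hβb u 0 s' (by rw [← hu]; norm_num), hb₀, hb₀]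
    · rw [hBβ, hBβ, Path.trans_apply, dif_neg (by linarith)]
      rfl
  let Q : C(S × I, C(I, Y)) := ContinuousMap.curry
    ⟨fun z : (S × I) × I => B ((squareMapSnd (z.1.2, z.2), squareMapFst (z.1.2, z.2)), z.1.1),
      by fun_prop⟩
  have hQ : ∀ z, Q z 0 = f (A (squareMapFst (z.2, 0), z.1)) := by
    rintro ⟨s, r⟩
    change B ((squareMapSnd (r, 0), squareMapFst (r, 0)), s) = _
    rcases le_total (r : ℝ) (1 / 2) with h | h
    · rw [squareMapSnd_bottom h, hBα]
    · rw [squareMapFst_bottom h, hB0]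
  refine ⟨⟨fun z => ⟨(A (squareMapFst (z.2, 0), z.1), Q z), hQ z⟩, by fun_prop⟩, fun s => ?_,
    fun z => ?_, fun s s' => ?_⟩
  · refine Subtype.ext (Prod.ext ?_ (ContinuousMap.ext fun t => ?_))
    · change A (squareMapFst (1, 0), s) = _
      rw [squareMapFst_bottom (by norm_num), hA0]
    · change B ((squareMapSnd (1, t), squareMapFst (1, t)), s) = _
      rw [squareMapSnd_right, hβH _ t s (coe_squareMapFst_right t)]
  · obtain ⟨s, r⟩ := z
    change B ((squareMapSnd (r, 1), squareMapFst (r, 1)), s) = _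
    rw [squareMapSnd_top, hβb _ r s (coe_squareMapFst_top r)]
  · refine Subtype.ext (Prod.ext ?_ (ContinuousMap.ext fun t => ?_))
    · have h1 : squareMapFst (0, 0) = 1 := by
        refine Set.projIcc_of_right_le _ ?_
        norm_num
      change A (squareMapFst (0, 0), s) = A (squareMapFst (0, 0), s')
      rw [h1, hA1, hA1]
    · change B ((squareMapSnd (0, t), squareMapFst (0, t)), s) =
        B ((squareMapSnd (0, t), squareMapFst (0, t)), s')
      rcases squareMap_left t with h | ⟨h, h'⟩
      · rw [h, hB1, hB1]
      · rw [h, hβδ _ s s' h']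

/-! ### Polar coordinates on the balls of the maximum norm -/

namespace TwoHot

instance (n : ℕ) : CompactSpace (sphere.{u} n) :=
  inferInstanceAs (CompactSpace (ULift (Metric.sphere (0 : EuclideanSpace ℝ (Fin (n + 1))) 1)))

instance (n : ℕ) : T2Space (sphere.{u} n) :=
  inferInstanceAs (T2Space (ULift (Metric.sphere (0 : EuclideanSpace ℝ (Fin (n + 1))) 1)))

/-- A point of the Euclidean unit sphere, as a vector of `Fin (n + 1) → ℝ`. -/
def sphereVec {n : ℕ} (s : sphere.{u} n) : Fin (n + 1) → ℝ :=
  WithLp.ofLp (ULift.down (α := Metric.sphere (0 : EuclideanSpace ℝ (Fin (n + 1))) 1) s).1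

@[fun_prop]
theorem continuous_sphereVec {n : ℕ} : Continuous (sphereVec.{u} (n := n)) :=
  (PiLp.continuous_ofLp 2 _).comp (continuous_subtype_val.comp continuous_uliftDown)

theorem norm_toLp_sphereVec {n : ℕ} (s : sphere.{u} n) :
    ‖WithLp.toLp 2 (sphereVec s)‖ = 1 :=
  mem_sphere_zero_iff_norm.1
    (ULift.down (α := Metric.sphere (0 : EuclideanSpace ℝ (Fin (n + 1))) 1) s).2

theorem sphereVec_ne_zero {n : ℕ} (s : sphere.{u} n) : sphereVec s ≠ 0 := by
  intro h
  have := norm_toLp_sphereVec s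
  simp [h] at this

theorem eq_of_smul_sphereVec_eq {n : ℕ} {s s' : sphere.{u} n} {c c' : ℝ} (hc : 0 < c)
    (hc' : 0 ≤ c') (h : c • sphereVec s = c' • sphereVec s') : s = s' := by
  have h1 := congrArg (fun v => ‖WithLp.toLp 2 v‖) h
  simp only [WithLp.toLp_smul, norm_smul, norm_toLp_sphereVec, mul_one, Real.norm_eq_abs,
    abs_of_pos hc, abs_of_nonneg hc'] at h1
  subst h1
  have h2 := smul_right_injective _ hc.ne' h
  exact ULift.down_injective (Subtype.ext (WithLp.ofLp_injective 2 h2))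

theorem exists_sphereVec {n : ℕ} {x : Fin (n + 1) → ℝ} (hx : x ≠ 0) :
    ∃ s : sphere.{u} n, ∃ c : ℝ, 0 < c ∧ x = c • sphereVec s := by
  have h0 : ‖WithLp.toLp 2 x‖ ≠ 0 := by simpa using hx
  refine ⟨ULift.up ⟨(‖WithLp.toLp 2 x‖)⁻¹ • WithLp.toLp 2 x, ?_⟩, ‖WithLp.toLp 2 x‖,
    by positivity, ?_⟩
  · rw [mem_sphere_zero_iff_norm, norm_smul, norm_inv, norm_norm, inv_mul_cancel₀ h0]
  · change x = _ • (_ • x)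
    rw [smul_smul, mul_inv_cancel₀ h0, one_smul]

instance (n : ℕ) : Nonempty (sphere.{u} n) :=
  ⟨(exists_sphereVec (one_ne_zero (α := Fin (n + 1) → ℝ))).choose⟩

/-- Polar coordinates on the unit ball of the maximum norm: the radial rescaling of the Euclidean
sphere to the unit sphere of the maximum norm, multiplied by the radius. -/
noncomputable def polar (n : ℕ) (z : sphere.{u} n × I) : Fin (n + 1) → ℝ :=
  ((z.2 : ℝ) * ‖sphereVec z.1‖⁻¹) • sphereVec z.1

theorem continuous_polar (n : ℕ) : Continuous (polar.{u} n) := by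
  have : ∀ z : sphere.{u} n × I, ‖sphereVec z.1‖ ≠ 0 := fun z =>
    norm_ne_zero_iff.2 (sphereVec_ne_zero z.1)
  unfold polar
  fun_prop (disch := assumption)

theorem norm_polar {n : ℕ} (z : sphere.{u} n × I) : ‖polar n z‖ = z.2 := by
  rw [polar, norm_smul, norm_mul, norm_inv, norm_norm, mul_assoc,
    inv_mul_cancel₀ (norm_ne_zero_iff.2 (sphereVec_ne_zero z.1)), mul_one,
    Real.norm_of_nonneg z.2.2.1]

theorem polar_mem_closedBall {n : ℕ} (z : sphere.{u} n × I) :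
    polar n z ∈ Metric.closedBall (0 : Fin (n + 1) → ℝ) 1 := by
  rw [mem_closedBall_zero_iff, norm_polar]
  exact z.2.2.2

/-- Polar coordinates only identify points at radius zero. -/
theorem eq_of_polar_eq {n : ℕ} {s s' : sphere.{u} n} {r r' : I}
    (h : polar n (s, r) = polar n (s', r')) :
    r = r' ∧ (r = 0 ∨ s = s') := by
  have hr : r = r' := Subtype.ext (by simpa only [norm_polar] using congrArg norm h)
  refine ⟨hr, ?_⟩
  rcases eq_or_ne r 0 with h0 | h0
  · exact Or.inl h0
  · refine Or.inr (eq_of_smul_sphereVec_eq ?_ ?_ h)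
    · exact mul_pos (unitInterval.pos_iff_ne_zero.2 h0)
        (inv_pos.2 (norm_pos_iff.2 (sphereVec_ne_zero s)))
    · exact mul_nonneg r'.2.1 (inv_nonneg.2 (norm_nonneg _))

theorem exists_polar_eq {n : ℕ} {x : Fin (n + 1) → ℝ} (hx : x ∈ Metric.closedBall 0 1) :
    ∃ z : sphere.{u} n × I, polar n z = x := by
  rw [mem_closedBall_zero_iff] at hx
  rcases eq_or_ne x 0 with rfl | h0
  · exact ⟨(Classical.arbitrary _, 0), by simp [polar]⟩
  · obtain ⟨s, c, hc, rfl⟩ := exists_sphereVec.{u} h0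
    refine ⟨(s, ⟨‖c • sphereVec s‖, norm_nonneg _, hx⟩), ?_⟩
    have := norm_ne_zero_iff.2 (sphereVec_ne_zero s)
    change (‖c • sphereVec s‖ * ‖sphereVec s‖⁻¹) • sphereVec s = _
    rw [norm_smul, Real.norm_of_nonneg hc.le, mul_assoc, mul_inv_cancel₀ this, mul_one]

/-- Polar coordinates as a continuous map onto the ball. -/
noncomputable def polarBall (n : ℕ) :
    C(sphere.{u} n × I, Metric.closedBall (0 : Fin (n + 1) → ℝ) 1) :=
  ⟨fun z => ⟨polar n z, polar_mem_closedBall z⟩, (continuous_polar n).subtype_mk _⟩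

theorem isQuotientMap_polarBall (n : ℕ) : IsQuotientMap (polarBall.{u} n) := by
  refine (polarBall n).continuous.isClosedMap.isQuotientMap (polarBall n).continuous ?_
  rintro ⟨x, hx⟩
  obtain ⟨z, hz⟩ := exists_polar_eq.{u} hx
  exact ⟨z, Subtype.ext hz⟩

end TwoHot

/-! ### Lifting maps out of CW complexes to the mapping path space -/

section

variable {X Y : Type*} [TopologicalSpace X] [TopologicalSpace Y] {f : C(X, Y)}

/-- Evaluating at a point of `S` shows that essential surjectivity of `Π₁(X^S) → Π₁(Y^S)` makes
`f` surjective on path components. -/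
theorem exists_path_of_essSurj {S : Type*} [TopologicalSpace S] [Nonempty S]
    (hf : (FundamentalGroupoid.map (MappingSpace.post S f)).EssSurj) (y : Y) :
    ∃ x : X, Nonempty (Path y (f x)) := by
  obtain ⟨⟨g⟩, ⟨i⟩⟩ := hf.mem_essImage ⟨ContinuousMap.const S y⟩
  obtain ⟨q, -⟩ := Path.Homotopic.Quotient.mk_surjective i.inv
  let s : S := Classical.arbitrary S
  exact ⟨g s, ⟨q.map (continuous_eval_const s)⟩⟩

/-- For cells of positive dimension this is `exists_cone_lift`, transported along polar
coordinates from the cylinder over `Sⁿ` to the ball of dimension `n + 1`. For a `0`-cell it is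
surjectivity on path components. -/
theorem hasBallLifting_endpoint
    (hf : ∀ n, (FundamentalGroupoid.map
      (MappingSpace.post (TwoHot.sphere.{u} n) f)).IsEquivalence) :
    HasBallLifting (MappingPathSpace.endpoint f) := by
  intro n a b ha hb hab
  obtain ⟨x₀, ⟨δ⟩⟩ := exists_path_of_essSurj (hf 0).essSurj (b 0)
  cases n with
  | zero =>
    refine ⟨fun _ => ⟨(x₀, δ.symm.toContinuousMap), δ.symm.source⟩, continuousOn_const, ?_, ?_⟩
    · intro x hx
      rw [Subsingleton.elim x 0, mem_sphere_zero_iff_norm, norm_zero] at hx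
      exact absurd hx zero_ne_one
    · intro x _
      rw [Subsingleton.elim x 0]
      exact δ.symm.target
  | succ n =>
    have hs : ∀ s : TwoHot.sphere.{u} n, TwoHot.polar n (s, 1) ∈ Metric.sphere 0 1 := fun s => by
      rw [mem_sphere_zero_iff_norm, TwoHot.norm_polar]
      rfl
    let a' : C(TwoHot.sphere.{u} n, MappingPathSpace f) :=
      ⟨fun s => a (TwoHot.polar n (s, 1)),
        ha.comp_continuous ((TwoHot.continuous_polar n).comp (by fun_prop)) hs⟩
    let b' : C(TwoHot.sphere.{u} n × I, Y) :=
      ⟨fun z => b (TwoHot.polar n z),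
        hb.comp_continuous (TwoHot.continuous_polar n) TwoHot.polar_mem_closedBall⟩
    obtain ⟨L, hL₁, hLb, hL₀⟩ := exists_cone_lift (hf n).full a' b' δ
      (fun s => (hab _ (hs s)).symm)
      (fun s => congrArg b (by simp [TwoHot.polar]))
    have hfac : Function.FactorsThrough L (TwoHot.polarBall n) := by
      rintro ⟨s, r⟩ ⟨s', r'⟩ h
      obtain ⟨rfl, rfl | rfl⟩ := TwoHot.eq_of_polar_eq (congrArg Subtype.val h)
      · exact hL₀ s s'
      · rfl
    let l := (TwoHot.isQuotientMap_polarBall n).lift L hfac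
    have hl : ∀ z, l (TwoHot.polarBall n z) = L z := fun z =>
      congrArg (fun g : C(_, _) => g z) ((TwoHot.isQuotientMap_polarBall n).lift_comp L hfac)
    classical
    let l' : (Fin (n + 1) → ℝ) → MappingPathSpace f := fun x =>
      if h : x ∈ Metric.closedBall (0 : Fin (n + 1) → ℝ) 1 then l ⟨x, h⟩ else a x
    have hll : ∀ x : Metric.closedBall (0 : Fin (n + 1) → ℝ) 1, l' x = l x := fun x =>
      dif_pos x.2
    have hl' : ∀ z, l' (TwoHot.polar n z) = L z := fun z =>
      (hll (TwoHot.polarBall n z)).trans (hl z)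
    refine ⟨l', ?_, fun x hx => ?_, fun x hx => ?_⟩
    · rw [continuousOn_iff_continuous_domRestrict]
      exact l.continuous.congr fun x => (hll x).symm
    · obtain ⟨⟨s, r⟩, rfl⟩ := TwoHot.exists_polar_eq.{u} (Metric.sphere_subset_closedBall hx)
      have hr : r = 1 := Subtype.ext (by
        rw [mem_sphere_zero_iff_norm, TwoHot.norm_polar] at hx
        exact hx)
      subst hr
      rw [hl', hL₁]
      rfl
    · obtain ⟨z, rfl⟩ := TwoHot.exists_polar_eq.{u} hx
      rw [hl', hLb]
      rfl

/-- A map that induces equivalences on the fundamental groupoids of the spaces of maps out of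
spheres has a right homotopy inverse, if its target has the homotopy type of a CW-complex. -/
theorem exists_comp_homotopic_id {X : Type*} {Y : Type u} [TopologicalSpace X]
    [TopologicalSpace Y] {f : C(X, Y)} (hY : HasCWHomotopyType Y)
    (hf : ∀ n, (FundamentalGroupoid.map
      (MappingSpace.post (TwoHot.sphere.{u} n) f)).IsEquivalence) :
    ∃ g : C(Y, X), (f.comp g).Homotopic (ContinuousMap.id Y) := by
  obtain ⟨W, _, _, ⟨_⟩, ⟨e⟩⟩ := hY
  have h0 : Nonempty W → Nonempty (MappingPathSpace f) := by
    rintro ⟨w⟩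
    obtain ⟨x, -⟩ := exists_path_of_essSurj (hf 0).essSurj (e.invFun w)
    exact ⟨⟨(x, ContinuousMap.const I (f x)), rfl⟩⟩
  obtain ⟨l, hl, hlb⟩ := (hasBallLifting_endpoint hf).exists_lift h0 e.invFun.continuous
  let g : C(W, X) := ⟨fun w => (l w).1.1, by fun_prop⟩
  have hg : (f.comp g).Homotopic e.invFun :=
    ⟨{ toFun := fun z => (l z.2).1.2 z.1
       continuous_toFun := by fun_prop
       map_zero_left := fun w => (l w).2
       map_one_left := hlb }⟩
  exact ⟨g.comp e.toFun,
    (ContinuousMap.Homotopic.comp hg (ContinuousMap.Homotopic.refl e.toFun)).trans e.left_inv⟩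

/-! ### Homotopy inverses -/

/-- Postcomposition with homotopic maps gives homotopic maps of mapping spaces. -/
theorem MappingSpace.post_homotopic {S : Type*} [TopologicalSpace S] [LocallyCompactSpace S]
    {f g : C(X, Y)} (H : f.Homotopic g) : (post S f).Homotopic (post S g) := by
  obtain ⟨H⟩ := H
  let E : C(I × C(S, X), C(S, Y)) := ContinuousMap.curry
    ⟨fun z : (I × C(S, X)) × S => H (z.1.1, z.1.2 z.2), by fun_prop⟩
  exact ⟨{ toContinuousMap := E
           map_zero_left := fun u => by ext s; simp [E, post]
           map_one_left := fun u => by ext s; simp [E, post] }⟩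

/-- `Π₁(Y^S) → Π₁(X^S) → Π₁(Y^S)` is isomorphic to the identity, so two-out-of-three applies. -/
theorem isEquivalence_map_post_of_comp_homotopic_id {S : Type*} [TopologicalSpace S]
    [LocallyCompactSpace S] {g : C(Y, X)}
    (hf : (FundamentalGroupoid.map (MappingSpace.post S f)).IsEquivalence)
    (h : (f.comp g).Homotopic (ContinuousMap.id Y)) :
    (FundamentalGroupoid.map (MappingSpace.post S g)).IsEquivalence := by
  obtain ⟨H⟩ := MappingSpace.post_homotopic (S := S) h
  have hid : FundamentalGroupoid.map (MappingSpace.post S (ContinuousMap.id Y)) = 𝟭 _ :=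
    FundamentalGroupoid.map_id
  have hcomp : FundamentalGroupoid.map (MappingSpace.post S (f.comp g)) =
      FundamentalGroupoid.map (MappingSpace.post S g) ⋙
        FundamentalGroupoid.map (MappingSpace.post S f) :=
    FundamentalGroupoid.map_comp (MappingSpace.post S f) (MappingSpace.post S g)
  have : (FundamentalGroupoid.map (MappingSpace.post S g) ⋙
      FundamentalGroupoid.map (MappingSpace.post S f)).IsEquivalence :=
    Functor.isEquivalence_of_iso
      (eqToIso hid.symm ≪≫ (asIso (FundamentalGroupoidFunctor.homotopicMapsNatIso H)).symm ≪≫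
        eqToIso hcomp)
  exact Functor.isEquivalence_of_comp_right _ (FundamentalGroupoid.map (MappingSpace.post S f))

end

/-- A right homotopy inverse `g` of `f` satisfies the same hypothesis as `f`, so it has a right
homotopy inverse `h` itself; then `h` is homotopic to `f g h`, hence to `f`. -/
theorem exists_homotopyEquiv_of_isEquivalence {X Y : Type u} [TopologicalSpace X]
    [TopologicalSpace Y] (hX : HasCWHomotopyType X) (hY : HasCWHomotopyType Y) (f : C(X, Y))
    (hf : ∀ n, (FundamentalGroupoid.map
      (MappingSpace.post (TwoHot.sphere.{u} n) f)).IsEquivalence) :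
    ∃ e : ContinuousMap.HomotopyEquiv X Y, e.toFun = f := by
  obtain ⟨g, hg⟩ := exists_comp_homotopic_id hY hf
  obtain ⟨h, hh⟩ := exists_comp_homotopic_id hX
    (fun n => isEquivalence_map_post_of_comp_homotopic_id (hf n) hg)
  have hfh : f.Homotopic h :=
    (ContinuousMap.Homotopic.comp (ContinuousMap.Homotopic.refl f) hh).symm.trans
      (ContinuousMap.Homotopic.comp hg (ContinuousMap.Homotopic.refl h))
  exact ⟨⟨f, g, (ContinuousMap.Homotopic.comp (ContinuousMap.Homotopic.refl g) hfh).trans hh, hg⟩,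
    rfl⟩

/-- A homotopy between maps is a path in the mapping space. -/
theorem ContinuousMap.Homotopic.nonempty_iso {X Y : Type*} [TopologicalSpace X]
    [TopologicalSpace Y] {f g : C(X, Y)} (h : f.Homotopic g) :
    Nonempty ((⟨f⟩ : FundamentalGroupoid C(X, Y)) ≅ ⟨g⟩) := by
  obtain ⟨H⟩ := h
  let q : Path f g :=
    { toContinuousMap := H.toContinuousMap.curry
      source' := by ext x; simp
      target' := by ext x; simp }
  exact ⟨asIso (X := (⟨f⟩ : FundamentalGroupoid C(X, Y))) (Y := ⟨g⟩)
    (Path.Homotopic.Quotient.mk q)⟩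

theorem theorem4p4 :
    JointlyReflectsEquivalences (Set.range (TwoHot.sphere : ℕ → TwoHot.{u})) ∧
    ∀ (X Y : TwoHot.{u}) (f : C(X, Y)),
      (∀ n : ℕ, (FundamentalGroupoid.map
        (MappingSpace.post (TwoHot.sphere.{u} n) f)).IsEquivalence) →
      ∃ e : ContinuousMap.HomotopyEquiv X Y, e.toFun = f := by
  have main : ∀ (X Y : TwoHot.{u}) (f : C(X, Y)),
      (∀ n : ℕ, (FundamentalGroupoid.map
        (MappingSpace.post (TwoHot.sphere.{u} n) f)).IsEquivalence) →
      ∃ e : ContinuousMap.HomotopyEquiv X Y, e.toFun = f := fun X Y f hf =>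
    exists_homotopyEquiv_of_isEquivalence X.hasCWHomotopyType Y.hasCWHomotopyType f hf
  refine ⟨fun X Y f hf => ?_, main⟩
  -- The functor `Bicategory.postcomp S f` is definitionally `Π₁` of postcomposition with `f.as`.
  obtain ⟨e, he⟩ := main X Y f.as fun n => hf _ ⟨n, rfl⟩
  refine ⟨⟨e.invFun⟩, ?_, ?_⟩
  · have := e.left_inv.nonempty_iso
    rw [he] at this
    exact this
  · have := e.right_inv.nonempty_iso
    rw [he] at this
    exact this
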